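/- Let $k \ge 4$ be an integer and let $G=(V,E)$ be a finite simple undirected graph. A star of $G$ is a subgraph consisting of a vertex (its center) together with edges to some, possibly zero, other vertices (its satellites); its order is its number of vertices, and an $\ell$-star ($\ell^+$-star, $\ell^-$-star) is a star of order exactly (at least, at most) $\ell$. Either vertex of a $2$-star may be taken as its center. A $k^-$-star partition of $G$ is a collection of pairwise vertex-disjoint $k^-$-stars of $G$ covering $V$; it is optimal if it has the minimum number of stars. Given a $k^-$-star partition $\mathcal S$, a star of $\mathcal S$ is tiny if it has order $2$ or $3$; a vertex is critical if it lies in a tiny star and is not a satellite of a $3$-star; critical vertices are separate if they lie in pairwise different stars of $\mathcal S$. The algorithm Approx1 starts with any $k^-$-star partition $\mathcal S$ having the minimum number of $1$-stars and, as long as one of the following operations is applicable, applies one (chosen arbitrarily) to update $\mathcal S$; it then returns $\mathcal S$. Operation 1. If $\{u,v\}\in E$, where $u$ is in a $2$-star of $\mathcal S$ and $v$ is a satellite of a $4^+$-star of $\mathcal S$ with center $c$, replace $\{c,v\}$ by $\{u,v\}$. Operation 2. If $S\in\mathcal S$ is a star with vertices $v_1,\dots,v_\ell$, $\ell\in\{2,3,4\}$,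 and there are separate critical vertices $w_1,\dots,w_\ell\notin V(S)$ with $\{v_j,w_j\}\in E$ for all $j$, replace the edges of $S$ by the edges $\{v_j,w_j\}$, $j=1,\dots,\ell$. Operation 3. Suppose that $S\in\mathcal S$ is a tiny star of order $\ell$ with center $v_1$ and that $W\in\mathcal S$, $W\neq S$, is a $2$-star with vertices $w_1,w_2$, both adjacent in $G$ to $v_1$. If $k\ge 5$ or $\ell=2$, replace $\{w_1,w_2\}$ by $\{w_1,v_1\}$ and $\{w_2,v_1\}$. Otherwise, if there is a critical vertex $w_3\notin V(S)\cup V(W)$ adjacent in $G$ to some satellite $v_j$ of $S$, replace $\{w_1,w_2\}$ and $\{v_1,v_j\}$ by $\{w_1,v_1\}$, $\{w_2,v_1\}$ and $\{w_3,v_j\}$. Then an admissible initial partition exists, Approx1 terminates on $G$ whatever choices it makes, and every collection $\mathcal S$ it can return is a $k^-$-star partition of $G$ such that, for every optimal $k^-$-star partition $\mathcal Q$ of $G$, $$|\mathcal S| \le \frac{2k^2-4k+1}{4k-7}\,|\mathcal Q|, \qquad \text{where } \frac{2k^2-4k+1}{4k-7} = \frac k2-\frac{k-2}{8k-14}.$$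 -/

import Mathlib

namespace StarPartition

variable {V : Type*} [DecidableEq V]

/-- A star `v₁-v₂…v_ℓ`, given by its center `v₁` and the set `{v₂, …, v_ℓ}` of its satellites.
A `2`-star has two such presentations: either of its vertices may be the chosen center. -/
structure Star (V : Type*) where
  center : V
  satellites : Finset V
deriving DecidableEq

/-- The vertex set of a star. -/
def Star.verts (S : Star V) : Finset V := insert S.center S.satellites

/-- The order of a star. An `ℓ`-star is a star of order `ℓ`. -/
def Star.order (S : Star V) : ℕ := S.verts.card

/-- `S` is a star of the graph `G`: its center is joined to all of its satellites (in particular,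
the center is not one of the satellites). -/
def Star.IsStarOf (S : Star V) (G : SimpleGraph V) : Prop :=
  ∀ v ∈ S.satellites, G.Adj S.center v

/-- `c` may be taken as the center of `S`. In a `2`-star the center is an arbitrary vertex. -/
def Star.IsCenter (S : Star V) (c : V) : Prop :=
  c = S.center ∨ (S.order = 2 ∧ c ∈ S.verts)

/-- A star is tiny if it has order `2` or `3`. -/
def Star.IsTiny (S : Star V) : Prop := S.order = 2 ∨ S.order = 3

/-- `v` is a critical vertex lying in the star `S`: the star is tiny and `v` is not a satellite of
a `3`-star. -/
def Star.IsCriticalIn (S : Star V) (v : V) : Prop :=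
  S.IsTiny ∧ v ∈ S.verts ∧ ¬ (S.order = 3 ∧ v ∈ S.satellites)

/-- The star on the vertices of `S` and the new vertex `v`, with center `c`
(used when `c` may be taken as the center of `S`): the edge `{c, v}` is added to `S`. -/
def Star.attach (S : Star V) (c v : V) : Star V := ⟨c, insert v (S.verts.erase c)⟩

/-- The star `S` with the edge from the center to the satellite `v`, and the vertex `v`, removed. -/
def Star.detach (S : Star V) (v : V) : Star V := ⟨S.center, S.satellites.erase v⟩

/-- `P` is a `k⁻`-star partition of `G`: a collection of vertex-disjoint stars of `G`, each of order
at most `k`, that covers all vertices of `G`. -/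
structure IsPartition (G : SimpleGraph V) (k : ℕ) (P : Finset (Star V)) : Prop where
  isStarOf : ∀ S ∈ P, S.IsStarOf G
  order_le : ∀ S ∈ P, S.order ≤ k
  disjoint : ∀ S ∈ P, ∀ T ∈ P, S ≠ T → Disjoint S.verts T.verts
  cover : ∀ v : V, ∃ S ∈ P, v ∈ S.verts

/-- An optimal `k⁻`-star partition: one with the minimum number of stars. -/
def IsOptimal (G : SimpleGraph V) (k : ℕ) (Q : Finset (Star V)) : Prop :=
  IsPartition G k Q ∧ ∀ P, IsPartition G k P → Q.card ≤ P.card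

/-- The number of `1`-stars in a collection of stars. -/
def numOneStars (P : Finset (Star V)) : ℕ := (P.filter fun S => S.order = 1).card

/-- The first operation: `u` is in a `2`-star `U`, `v` is a satellite of a `4⁺`-star `C` with center `c`, and
`{u, v}` is an edge. The edge `{c, v}` is replaced by `{u, v}`. -/
def Op1 (G : SimpleGraph V) (P P' : Finset (Star V)) : Prop :=
  ∃ U ∈ P, ∃ C ∈ P, ∃ u v : V,
    U.order = 2 ∧ u ∈ U.verts ∧ 4 ≤ C.order ∧ v ∈ C.satellites ∧ G.Adj u v ∧
    P' = (P \ {U, C}) ∪ {U.attach u v, C.detach v}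

/-- The second operation: `S` is a star of order `2`, `3` or `4`, and every vertex `v` of `S` is adjacent to a
critical vertex `w v` outside `S`, lying in the star `W v`, where these critical vertices are
pairwise separate (lie in different stars). The edges of `S` are replaced by the edges
`{v, w v}`. -/
def Op2 (G : SimpleGraph V) (P P' : Finset (Star V)) : Prop :=
  ∃ S ∈ P, ∃ (w : V → V) (W : V → Star V),
    2 ≤ S.order ∧ S.order ≤ 4 ∧
    (∀ v ∈ S.verts, W v ∈ P ∧ (W v).IsCriticalIn (w v) ∧ w v ∉ S.verts ∧ G.Adj v (w v)) ∧
    (∀ v ∈ S.verts, ∀ v' ∈ S.verts, v ≠ v' → W v ≠ W v') ∧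
    P' = (P \ insert S (S.verts.image W)) ∪ S.verts.image fun v => (W v).attach (w v) v

/-- The third operation: `S` is a tiny star with center `v₁`, and both vertices of another star `W`, of
order `2`, are adjacent to `v₁`.
If `k ≥ 5` or `S` is a `2`-star, then `W` is merged into `S` (its edge is replaced by the two edges
from `v₁` to its vertices).
Otherwise a further critical vertex `w₃`, in neither `S` nor `W` and lying in the star `W₃`, is
required that is adjacent to a satellite `vⱼ` of `S`; then `W` is merged into `S`, and the edge
`{v₁, vⱼ}` is replaced by `{w₃, vⱼ}`. -/
def Op3 (G : SimpleGraph V) (k : ℕ) (P P' : Finset (Star V)) : Prop :=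
  ∃ S ∈ P, ∃ W ∈ P, ∃ v₁ : V,
    S ≠ W ∧ S.IsTiny ∧ S.IsCenter v₁ ∧ W.order = 2 ∧ (∀ w ∈ W.verts, G.Adj v₁ w) ∧
    (((5 ≤ k ∨ S.order = 2) ∧
        P' = (P \ {S, W}) ∪ {⟨v₁, S.verts.erase v₁ ∪ W.verts⟩}) ∨
      (¬ (5 ≤ k ∨ S.order = 2) ∧
        ∃ W₃ ∈ P, ∃ w₃ vⱼ : V,
          W₃.IsCriticalIn w₃ ∧ w₃ ∉ S.verts ∪ W.verts ∧ vⱼ ∈ S.verts.erase v₁ ∧ G.Adj w₃ vⱼ ∧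
          P' = (P \ {S, W, W₃}) ∪
            {⟨v₁, (S.verts.erase v₁).erase vⱼ ∪ W.verts⟩, W₃.attach w₃ vⱼ}))

/-- One iteration of the while-loop: one of the three operations turns `P` into `P'`. -/
def Step (G : SimpleGraph V) (k : ℕ) (P P' : Finset (Star V)) : Prop :=
  Op1 G P P' ∨ Op2 G P P' ∨ Op3 G k P P'

/-- A possible initial collection of the algorithm: a `k⁻`-star partition with the least number of
`1`-stars. -/
def IsApprox1Start (G : SimpleGraph V) (k : ℕ) (P : Finset (Star V)) : Prop :=
  IsPartition G k P ∧ ∀ P', IsPartition G k P' → numOneStars P ≤ numOneStars P'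

/-- `P` is a possible output of the algorithm Approx1 on the graph `G`: it is reached from a possible
initial collection by finitely many operations, and no operation is applicable to it. -/
def IsApprox1Output (G : SimpleGraph V) (k : ℕ) (P : Finset (Star V)) : Prop :=
  ∃ P₀, IsApprox1Start G k P₀ ∧ Relation.ReflTransGen (Step G k) P₀ P ∧ ∀ P', ¬ Step G k P P'

end StarPartition

set_option linter.unusedSectionVars false

/-! ### Vertices, orders and centers of stars. -/

namespace StarPartition

variable {V : Type*} [DecidableEq V] {G : SimpleGraph V} {k : ℕ} {P Q : Finset (Star V)}
  {S T : Star V} {u v w : V} {p q : V → Star V}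

/-! Each operation yields a partition again, creates no 1-star, and lowers the pair (number of
stars, number of 2-stars) lexicographically. Hence every run stops, and an output P still has the
minimum number of 1-stars. The bound draws on this minimality (`IsStuck.of_adj_one`), on the failure
of Operation 2 (`IsStuck.not_separate`) and on the failure of Operation 3 for two 2-stars
(`IsStuck.not_adj_two`); `Config` collects these facts.

The bound is a discharging argument against an arbitrary partition Q. A star S of P owns
(4k-7)·max(|S|-2, 0) units of charge and hands `income` to its vertices (`Config.sum_income_le`). A
star T of Q collects the income of its vertices and (4k-7)(k-|T|-[|T|=1]) units for its unused
capacity, and has to keep k-2. The obstacle is a bad star: it has order k and all its vertices lie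
in 2-stars of P, so it collects nothing. But at least k-2 of its satellites have a partner in P (a
link) other than its center, and the star of Q containing a link pays one unit for it. It can afford
this because, by `Config.link_center`, a link forces many strong vertices or a strong center; a
strong center of a k-star of Q receives k-2 and one more unit for each load. The 3-stars of P are
tight: when the center is spare it returns one unit, and its star in Q has to cover that unit as
well, so spare centers also count as loads.

`Config.le_sum_income` is the resulting inequality for one star of Q. In the sum over all stars the
vertex counts cancel, the 1-star terms have the right sign by minimality, and (k-2)|Q| ≤
(4k-7)(k|Q|-2|P|) remains, which is the claim. -/

theorem Star.center_mem_verts (S : Star V) : S.center ∈ S.verts :=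
  Finset.mem_insert_self _ _

theorem Star.mem_verts_of_mem_satellites (h : v ∈ S.satellites) : v ∈ S.verts :=
  Finset.mem_insert_of_mem h

theorem Star.mem_satellites_of_ne_center (h : v ∈ S.verts) (hv : v ≠ S.center) :
    v ∈ S.satellites :=
  (Finset.mem_insert.1 h).resolve_left hv

theorem Star.order_pos (S : Star V) : 0 < S.order :=
  Finset.card_pos.2 ⟨_, S.center_mem_verts⟩

theorem Star.IsStarOf.center_notMem (h : S.IsStarOf G) : S.center ∉ S.satellites :=
  fun hc => G.irrefl (h _ hc)

theorem Star.IsStarOf.ne_center (h : S.IsStarOf G) (hv : v ∈ S.satellites) : v ≠ S.center :=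
  fun e => h.center_notMem (e ▸ hv)

theorem Star.IsStarOf.card_satellites (h : S.IsStarOf G) : S.satellites.card + 1 = S.order :=
  (Finset.card_insert_of_notMem h.center_notMem).symm

/-- In a star of order `2`, the other vertex is adjacent to either of them. -/
theorem Star.IsStarOf.adj_of_order_eq_two (h : S.IsStarOf G) (h2 : S.order = 2)
    (hu : u ∈ S.verts) (hv : v ∈ S.verts) (huv : u ≠ v) : G.Adj u v := by
  have hc := h.card_satellites
  obtain ⟨s, hs⟩ := Finset.card_eq_one.1 (by omega : S.satellites.card = 1)
  have ha : G.Adj S.center s := h s (by simp [hs])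
  simp only [Star.verts, hs, Finset.mem_insert, Finset.mem_singleton] at hu hv
  rcases hu with rfl | rfl <;> rcases hv with rfl | rfl
  · exact absurd rfl huv
  · exact ha
  · exact ha.symm
  · exact absurd rfl huv

theorem Star.IsStarOf.adj_of_isCenter (h : S.IsStarOf G) (hu : S.IsCenter u)
    (hv : v ∈ S.verts) (huv : v ≠ u) : G.Adj u v := by
  rcases hu with rfl | ⟨h2, hu⟩
  · exact h v (Star.mem_satellites_of_ne_center hv huv)
  · exact h.adj_of_order_eq_two h2 hu hv huv.symm

theorem Star.IsCenter.mem_verts (h : S.IsCenter v) : v ∈ S.verts := by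
  rcases h with rfl | h
  exacts [S.center_mem_verts, h.2]

theorem Star.IsCriticalIn.isCenter (h : S.IsCriticalIn v) : S.IsCenter v := by
  obtain ⟨h2 | h3, hv, hn⟩ := h
  · exact Or.inr ⟨h2, hv⟩
  · exact Or.inl (by_contra fun hc => hn ⟨h3, Star.mem_satellites_of_ne_center hv hc⟩)

theorem Star.verts_attach (hu : u ∈ S.verts) : (S.attach u v).verts = insert v S.verts := by
  ext x
  simp only [Star.attach, Star.verts, Finset.mem_insert, Finset.mem_erase] at hu ⊢
  by_cases hx : x = u
  · subst hx; simp [hu]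
  · simp [hx]

theorem Star.order_attach (hu : u ∈ S.verts) (hv : v ∉ S.verts) :
    (S.attach u v).order = S.order + 1 := by
  rw [Star.order, Star.verts_attach hu, Finset.card_insert_of_notMem hv, Star.order]

theorem Star.IsStarOf.attach (h : S.IsStarOf G) (hu : S.IsCenter u) (huv : G.Adj u v) :
    (S.attach u v).IsStarOf G := by
  intro x hx
  simp only [Star.attach, Finset.mem_insert, Finset.mem_erase] at hx ⊢
  rcases hx with rfl | ⟨hxu, hx⟩
  exacts [huv, h.adj_of_isCenter hu hx hxu]

theorem Star.IsStarOf.verts_detach (h : S.IsStarOf G) (hv : v ∈ S.satellites) :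
    (S.detach v).verts = S.verts.erase v := by
  rw [Star.verts, Star.verts, Star.detach, Finset.erase_insert_of_ne (h.ne_center hv).symm]

theorem Star.IsStarOf.order_detach (h : S.IsStarOf G) (hv : v ∈ S.satellites) :
    (S.detach v).order + 1 = S.order := by
  rw [Star.order, h.verts_detach hv,
    Finset.card_erase_add_one (Star.mem_verts_of_mem_satellites hv), Star.order]

theorem Star.IsStarOf.detach (h : S.IsStarOf G) : (S.detach v).IsStarOf G :=
  fun x hx => h x (Finset.mem_of_mem_erase hx)

/-! ### Partitions and exchange of stars. -/

namespace IsPartition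

/-- The star of a partition that contains a given vertex. -/
noncomputable def starAt (h : IsPartition G k P) (v : V) : Star V := (h.cover v).choose

theorem starAt_mem (h : IsPartition G k P) (v : V) : h.starAt v ∈ P := (h.cover v).choose_spec.1

theorem mem_starAt (h : IsPartition G k P) (v : V) : v ∈ (h.starAt v).verts :=
  (h.cover v).choose_spec.2

theorem eq_of_mem (h : IsPartition G k P) (hS : S ∈ P) (hT : T ∈ P) (hvS : v ∈ S.verts)
    (hvT : v ∈ T.verts) : S = T := by
  by_contra hne
  exact Finset.disjoint_left.1 (h.disjoint S hS T hT hne) hvS hvT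

theorem starAt_eq (h : IsPartition G k P) (hS : S ∈ P) (hv : v ∈ S.verts) : h.starAt v = S :=
  h.eq_of_mem (h.starAt_mem v) hS (h.mem_starAt v) hv

theorem sum_sum_verts [Fintype V] (h : IsPartition G k P) {M : Type*} [AddCommMonoid M]
    (f : V → M) : ∑ S ∈ P, ∑ v ∈ S.verts, f v = ∑ v, f v := by
  rw [← Finset.sum_biUnion (fun S hS T hT hne => h.disjoint S hS T hT hne)]
  congr 1
  ext v
  simp only [Finset.mem_biUnion, Finset.mem_univ, iff_true]
  exact h.cover v

/-- Replacing the stars in `A` by stars on the same vertices. -/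
theorem replace (h : IsPartition G k P) {A B : Finset (Star V)} (hA : A ⊆ P)
    (hstar : ∀ S ∈ B, S.IsStarOf G) (hord : ∀ S ∈ B, S.order ≤ k)
    (hdisj : ∀ S ∈ B, ∀ T ∈ B, S ≠ T → Disjoint S.verts T.verts)
    (hverts : A.biUnion Star.verts = B.biUnion Star.verts) : IsPartition G k (P \ A ∪ B) := by
  have key : ∀ S ∈ P \ A, ∀ T ∈ B, Disjoint S.verts T.verts := by
    intro S hS T hT
    rw [Finset.mem_sdiff] at hS
    rw [Finset.disjoint_left]
    intro v hvS hvT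
    have : v ∈ A.biUnion Star.verts := hverts ▸ Finset.mem_biUnion.2 ⟨T, hT, hvT⟩
    obtain ⟨T', hT', hv'⟩ := Finset.mem_biUnion.1 this
    exact hS.2 (h.eq_of_mem hS.1 (hA hT') hvS hv' ▸ hT')
  refine ⟨?_, ?_, ?_, ?_⟩
  · intro S hS
    rcases Finset.mem_union.1 hS with hS | hS
    exacts [h.isStarOf S (Finset.mem_sdiff.1 hS).1, hstar S hS]
  · intro S hS
    rcases Finset.mem_union.1 hS with hS | hS
    exacts [h.order_le S (Finset.mem_sdiff.1 hS).1, hord S hS]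
  · intro S hS T hT hne
    rcases Finset.mem_union.1 hS with hS | hS <;> rcases Finset.mem_union.1 hT with hT | hT
    · exact h.disjoint S (Finset.mem_sdiff.1 hS).1 T (Finset.mem_sdiff.1 hT).1 hne
    · exact key S hS T hT
    · exact (key T hT S hS).symm
    · exact hdisj S hS T hT hne
  · intro v
    by_cases hv : h.starAt v ∈ A
    · have : v ∈ B.biUnion Star.verts :=
        hverts ▸ Finset.mem_biUnion.2 ⟨_, hv, h.mem_starAt v⟩
      obtain ⟨T, hT, hvT⟩ := Finset.mem_biUnion.1 this
      exact ⟨T, Finset.mem_union_right _ hT, hvT⟩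
    · exact ⟨_, Finset.mem_union_left _ (Finset.mem_sdiff.2 ⟨h.starAt_mem v, hv⟩), h.mem_starAt v⟩

end IsPartition

/-! ### The operations preserve partitions and make progress. -/

/-- The number of `2`-stars in a collection of stars. -/
def numTwoStars (P : Finset (Star V)) : ℕ := (P.filter fun S => S.order = 2).card

theorem card_filter_replace_le {p : Star V → Prop} [DecidablePred p] {A B : Finset (Star V)}
    (hB : ∀ S ∈ B, ¬ p S) : ((P \ A ∪ B).filter p).card ≤ (P.filter p).card := by
  refine Finset.card_le_card fun S hS => ?_
  simp only [Finset.mem_filter, Finset.mem_union, Finset.mem_sdiff] at hS ⊢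
  rcases hS with ⟨h | h, hp⟩
  exacts [⟨h.1, hp⟩, absurd hp (hB S h)]

theorem card_filter_replace_lt {p : Star V → Prop} [DecidablePred p] {A B : Finset (Star V)}
    (hB : ∀ S ∈ B, ¬ p S) (hA : S ∈ A) (hS : S ∈ P) (hp : p S) :
    ((P \ A ∪ B).filter p).card < (P.filter p).card := by
  refine Finset.card_lt_card ((Finset.ssubset_iff_of_subset fun T hT => ?_).2 ⟨S, ?_, ?_⟩)
  · simp only [Finset.mem_filter, Finset.mem_union, Finset.mem_sdiff] at hT ⊢
    rcases hT with ⟨h | h, hp⟩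
    exacts [⟨h.1, hp⟩, absurd hp (hB T h)]
  · simp [hS, hp]
  · simp only [Finset.mem_filter, Finset.mem_union, Finset.mem_sdiff, not_and_or, not_or]
    exact Or.inl ⟨Or.inr (not_not.2 hA), fun h => hB S h hp⟩

theorem card_replace_le {A B : Finset (Star V)} (hA : A ⊆ P) (h : B.card ≤ A.card) :
    (P \ A ∪ B).card ≤ P.card := by
  have h1 := Finset.card_union_le (P \ A) B
  have h2 := Finset.card_sdiff_add_card_eq_card hA
  omega

theorem card_replace_lt {A B : Finset (Star V)} (hA : A ⊆ P) (h : B.card < A.card) :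
    (P \ A ∪ B).card < P.card := by
  have h1 := Finset.card_union_le (P \ A) B
  have h2 := Finset.card_sdiff_add_card_eq_card hA
  omega

/-- What each operation guarantees: the result is a partition again, without new `1`-stars, and
the number of stars or the number of `2`-stars goes down. -/
structure Improves (G : SimpleGraph V) (k : ℕ) (P P' : Finset (Star V)) : Prop where
  isPartition : IsPartition G k P'
  numOneStars_le : numOneStars P' ≤ numOneStars P
  lex : P'.card < P.card ∨ P'.card ≤ P.card ∧ numTwoStars P' < numTwoStars P

/-- The 2-star grows to order 3 and the other star keeps at least 3 vertices, so a 2-star disappears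
while the number of stars does not grow. -/
theorem Op1.improves {P' : Finset (Star V)} (hk : 4 ≤ k) (h : IsPartition G k P)
    (ho : Op1 G P P') : Improves G k P P' := by
  obtain ⟨U, hU, C, hC, u, v, hU2, hu, hC4, hv, huv, rfl⟩ := ho
  have hUC : U ≠ C := by rintro rfl; omega
  have hd := h.disjoint U hU C hC hUC
  have hvC := Star.mem_verts_of_mem_satellites hv
  have hvU : v ∉ U.verts := fun hx => Finset.disjoint_left.1 hd hx hvC
  have hoU := Star.order_attach (v := v) hu hvU
  have hoC := (h.isStarOf C hC).order_detach hv
  have hCk := h.order_le C hC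
  have hsub : ({U, C} : Finset (Star V)) ⊆ P := by
    simp [Finset.insert_subset_iff, hU, hC]
  have hvU' := Star.verts_attach (v := v) hu
  have hvC' := (h.isStarOf C hC).verts_detach hv
  have hB : ∀ S ∈ ({U.attach u v, C.detach v} : Finset (Star V)), 3 ≤ S.order := by
    simp only [Finset.mem_insert, Finset.mem_singleton]
    rintro S (rfl | rfl) <;> omega
  have hdis : Disjoint (U.attach u v).verts (C.detach v).verts := by
    rw [hvU', hvC', Finset.disjoint_left]
    intro x hx hx'
    rw [Finset.mem_erase] at hx'
    exact Finset.disjoint_left.1 hd ((Finset.mem_insert.1 hx).resolve_left hx'.1) hx'.2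
  refine ⟨h.replace hsub ?_ ?_ ?_ ?_, ?_, Or.inr ⟨?_, ?_⟩⟩
  · simp only [Finset.mem_insert, Finset.mem_singleton]
    rintro S (rfl | rfl)
    exacts [(h.isStarOf U hU).attach (Or.inr ⟨hU2, hu⟩) huv, (h.isStarOf C hC).detach]
  · simp only [Finset.mem_insert, Finset.mem_singleton]
    rintro S (rfl | rfl) <;> omega
  · simp only [Finset.mem_insert, Finset.mem_singleton]
    rintro S (rfl | rfl) T (rfl | rfl) hne
    exacts [absurd rfl hne, hdis, hdis.symm, absurd rfl hne]
  · simp only [Finset.biUnion_insert, Finset.singleton_biUnion, hvU', hvC']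
    ext x
    simp only [Finset.mem_union, Finset.mem_insert, Finset.mem_erase]
    by_cases hx : x = v
    · subst hx; simp [hvC]
    · simp [hx]
  · exact card_filter_replace_le fun S hS => by have := hB S hS; omega
  · refine card_replace_le hsub ?_
    rw [Finset.card_pair hUC]
    exact Finset.card_le_two
  · exact card_filter_replace_lt (fun S hS => by have := hB S hS; omega)
      (Finset.mem_insert_self U {C}) hU hU2

/-- The vertices of `S` are distributed over the tiny stars of their critical neighbors, so `S`
disappears. The enlarged stars have order at most 4, hence at most `k`. -/
theorem Op2.improves {P' : Finset (Star V)} (hk : 4 ≤ k) (h : IsPartition G k P)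
    (ho : Op2 G P P') : Improves G k P P' := by
  obtain ⟨S, hS, w, W, -, -, hw, hW, rfl⟩ := ho
  have hWS : ∀ v ∈ S.verts, Disjoint (W v).verts S.verts := fun v hv =>
    h.disjoint _ (hw v hv).1 S hS fun e => (hw v hv).2.2.1 (e ▸ (hw v hv).2.1.2.1)
  have hvW : ∀ v ∈ S.verts, ∀ x ∈ S.verts, x ∉ (W v).verts := fun v hv x hx hx' =>
    Finset.disjoint_left.1 (hWS v hv) hx' hx
  have hWW : ∀ v ∈ S.verts, ∀ v' ∈ S.verts, v ≠ v' → Disjoint (W v).verts (W v').verts :=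
    fun v hv v' hv' hne => h.disjoint _ (hw v hv).1 _ (hw v' hv').1 (hW v hv v' hv' hne)
  have hverts : ∀ v ∈ S.verts, ((W v).attach (w v) v).verts = insert v (W v).verts :=
    fun v hv => Star.verts_attach (hw v hv).2.1.2.1
  have hord : ∀ v ∈ S.verts, ((W v).attach (w v) v).order = (W v).order + 1 :=
    fun v hv => Star.order_attach (hw v hv).2.1.2.1 (hvW v hv v hv)
  have htiny : ∀ v ∈ S.verts, (W v).order = 2 ∨ (W v).order = 3 := fun v hv => (hw v hv).2.1.1
  have hSW : S ∉ S.verts.image W := by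
    intro hm
    obtain ⟨v, hv, e⟩ := Finset.mem_image.1 hm
    exact hvW v hv v hv (e ▸ hv)
  have hsub : insert S (S.verts.image W) ⊆ P := by
    rw [Finset.insert_subset_iff, Finset.image_subset_iff]
    exact ⟨hS, fun v hv => (hw v hv).1⟩
  refine ⟨h.replace hsub ?_ ?_ ?_ ?_, ?_, Or.inl (card_replace_lt hsub ?_)⟩
  · intro T hT
    obtain ⟨v, hv, rfl⟩ := Finset.mem_image.1 hT
    exact (h.isStarOf _ (hw v hv).1).attach (hw v hv).2.1.isCenter (hw v hv).2.2.2.symm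
  · intro T hT
    obtain ⟨v, hv, rfl⟩ := Finset.mem_image.1 hT
    have := hord v hv
    have := htiny v hv
    omega
  · intro T hT T' hT' hne
    obtain ⟨v, hv, rfl⟩ := Finset.mem_image.1 hT
    obtain ⟨v', hv', rfl⟩ := Finset.mem_image.1 hT'
    have hvv : v ≠ v' := by rintro rfl; exact hne rfl
    rw [hverts v hv, hverts v' hv']
    simp only [Finset.disjoint_insert_left, Finset.disjoint_insert_right, Finset.mem_insert,
      not_or]
    exact ⟨⟨hvv.symm, hvW v hv v' hv'⟩, hvW v' hv' v hv, hWW v hv v' hv' hvv⟩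
  · ext x
    simp only [Finset.biUnion_insert, Finset.mem_union, Finset.mem_biUnion, Finset.mem_image]
    constructor
    · rintro (hx | ⟨_, ⟨v, hv, rfl⟩, hx⟩)
      · exact ⟨_, ⟨x, hx, rfl⟩, by rw [hverts x hx]; exact Finset.mem_insert_self _ _⟩
      · exact ⟨_, ⟨v, hv, rfl⟩, by rw [hverts v hv]; exact Finset.mem_insert_of_mem hx⟩
    · rintro ⟨_, ⟨v, hv, rfl⟩, hx⟩
      rw [hverts v hv, Finset.mem_insert] at hx
      rcases hx with rfl | hx
      exacts [Or.inl hv, Or.inr ⟨_, ⟨v, hv, rfl⟩, hx⟩]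
  · refine card_filter_replace_le fun T hT => ?_
    obtain ⟨v, hv, rfl⟩ := Finset.mem_image.1 hT
    have := hord v hv
    have := htiny v hv
    omega
  · rw [Finset.card_insert_of_notMem hSW, Finset.card_image_of_injOn (f := W)]
    · exact Nat.lt_succ_of_le Finset.card_image_le
    · intro v hv v' hv' e
      by_contra hne
      exact hW v hv v' hv' hne e

theorem Op3.improves {P' : Finset (Star V)} (hk : 4 ≤ k) (h : IsPartition G k P)
    (ho : Op3 G k P P') : Improves G k P P' := by
  obtain ⟨S, hS, W, hW, c, hSW, htiny, hc, hW2, hadj, ⟨hcase, rfl⟩ | ⟨hcase, W', hW', w, x, hw, hwn,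
    hx, hwx, rfl⟩⟩ := ho
  all_goals
    have hd := h.disjoint S hS W hW hSW
    have hcS := hc.mem_verts
    have hW2' : W.verts.card = 2 := hW2
    have hSc : S.verts.card = 2 ∨ S.verts.card = 3 := htiny
  · have hverts : (⟨c, S.verts.erase c ∪ W.verts⟩ : Star V).verts = S.verts ∪ W.verts := by
      rw [Star.verts, ← Finset.insert_union, Finset.insert_erase hcS]
    have hord : (⟨c, S.verts.erase c ∪ W.verts⟩ : Star V).order = S.order + 2 := by
      rw [Star.order, hverts, Finset.card_union_of_disjoint hd, hW2', Star.order]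
    have hSo : S.order = S.verts.card := rfl
    have hsub : ({S, W} : Finset (Star V)) ⊆ P := by
      simp [Finset.insert_subset_iff, hS, hW]
    refine ⟨h.replace hsub ?_ ?_ ?_ ?_, ?_, Or.inl (card_replace_lt hsub ?_)⟩
    · simp only [Finset.mem_singleton, forall_eq]
      intro y hy
      rcases Finset.mem_union.1 hy with hy | hy
      · exact (h.isStarOf S hS).adj_of_isCenter hc (Finset.mem_of_mem_erase hy)
          (Finset.ne_of_mem_erase hy)
      · exact hadj y hy
    · simp only [Finset.mem_singleton, forall_eq]
      omega
    · simp only [Finset.mem_singleton]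
      rintro _ rfl _ rfl hne
      exact absurd rfl hne
    · simp only [Finset.biUnion_insert, Finset.singleton_biUnion, hverts]
    · refine card_filter_replace_le fun T hT => ?_
      rw [Finset.mem_singleton.1 hT]
      omega
    · rw [Finset.card_pair hSW, Finset.card_singleton]
      exact one_lt_two
  -- Merging alone would give order 5, which is too large here. The satellite `x` moves to `W'`, so
  -- three stars become two, each of order at most 4.
  · have hSo : S.order = S.verts.card := rfl
    have hw' : w ∈ W'.verts := hw.2.1
    have hS3 : S.verts.card = 3 := by omega
    simp only [Finset.mem_union, not_or] at hwn
    have hSW' : S ≠ W' := by rintro rfl; exact hwn.1 hw'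
    have hWW' : W ≠ W' := by rintro rfl; exact hwn.2 hw'
    have hdS := h.disjoint S hS W' hW' hSW'
    have hdW := h.disjoint W hW W' hW' hWW'
    obtain ⟨hxc, hxS⟩ := Finset.mem_erase.1 hx
    have hxW : x ∉ W.verts := Finset.disjoint_left.1 hd hxS
    have hxW' : x ∉ W'.verts := Finset.disjoint_left.1 hdS hxS
    have hverts : (⟨c, (S.verts.erase c).erase x ∪ W.verts⟩ : Star V).verts =
        S.verts.erase x ∪ W.verts := by
      rw [Star.verts, ← Finset.insert_union, Finset.erase_right_comm,
        Finset.insert_erase (Finset.mem_erase.2 ⟨hxc.symm, hcS⟩)]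
    have hord : (⟨c, (S.verts.erase c).erase x ∪ W.verts⟩ : Star V).order = 4 := by
      rw [Star.order, hverts, Finset.card_union_of_disjoint
        (hd.mono_left (Finset.erase_subset _ _)), hW2', Finset.card_erase_of_mem hxS, hS3]
    have hverts' := Star.verts_attach (v := x) hw'
    have hord' := Star.order_attach hw' hxW'
    have htiny' : W'.order = 2 ∨ W'.order = 3 := hw.1
    have hsub : ({S, W, W'} : Finset (Star V)) ⊆ P := by
      simp [Finset.insert_subset_iff, hS, hW, hW']
    have hdis : Disjoint (⟨c, (S.verts.erase c).erase x ∪ W.verts⟩ : Star V).verts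
        (W'.attach w x).verts := by
      rw [hverts, hverts', Finset.disjoint_insert_right, Finset.disjoint_union_left]
      refine ⟨?_, hdS.mono_left (Finset.erase_subset _ _), hdW⟩
      simp [hxW]
    refine ⟨h.replace hsub ?_ ?_ ?_ ?_, ?_, Or.inl (card_replace_lt hsub ?_)⟩
    · simp only [Finset.mem_insert, Finset.mem_singleton]
      rintro T (rfl | rfl)
      · intro y hy
        rcases Finset.mem_union.1 hy with hy | hy
        · have hy := Finset.mem_of_mem_erase hy
          exact (h.isStarOf S hS).adj_of_isCenter hc (Finset.mem_of_mem_erase hy)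
            (Finset.ne_of_mem_erase hy)
        · exact hadj y hy
      · exact (h.isStarOf _ hW').attach hw.isCenter hwx
    · simp only [Finset.mem_insert, Finset.mem_singleton]
      rintro T (rfl | rfl) <;> omega
    · simp only [Finset.mem_insert, Finset.mem_singleton]
      rintro _ (rfl | rfl) _ (rfl | rfl) hne
      exacts [absurd rfl hne, hdis, hdis.symm, absurd rfl hne]
    · simp only [Finset.biUnion_insert, Finset.singleton_biUnion, hverts, hverts']
      ext y
      simp only [Finset.mem_union, Finset.mem_insert, Finset.mem_erase]
      by_cases hy : y = x
      · subst hy; simp [hxS]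
      · simp [hy, or_assoc]
    · refine card_filter_replace_le fun T hT => ?_
      simp only [Finset.mem_insert, Finset.mem_singleton] at hT
      rcases hT with rfl | rfl <;> omega
    · rw [Finset.card_insert_of_notMem (show S ∉ ({W, W'} : Finset (Star V)) by simp [hSW, hSW']),
        Finset.card_pair hWW']
      exact Nat.lt_succ_of_le Finset.card_le_two

theorem Step.improves {P' : Finset (Star V)} (hk : 4 ≤ k) (h : IsPartition G k P)
    (hs : Step G k P P') : Improves G k P P' := by
  rcases hs with hs | hs | hs
  exacts [hs.improves hk h, hs.improves hk h, hs.improves hk h]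

/-! ### Existence of a start, and termination. -/

theorem isPartition_singletons [Fintype V] (G : SimpleGraph V) (hk : 1 ≤ k) :
    IsPartition G k (Finset.univ.image fun v : V => (⟨v, ∅⟩ : Star V)) := by
  refine ⟨?_, ?_, ?_, ?_⟩
  · simp [Star.IsStarOf]
  · simp [Star.order, Star.verts, hk]
  · simp only [Finset.mem_image, Finset.mem_univ, true_and]
    rintro _ ⟨u, rfl⟩ _ ⟨v, rfl⟩ hne
    simp only [Star.verts, insert_empty_eq, Finset.disjoint_singleton]
    rintro rfl
    exact hne rfl
  · exact fun v => ⟨⟨v, ∅⟩, by simp, by simp [Star.verts]⟩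

theorem exists_isApprox1Start [Fintype V] (G : SimpleGraph V) (hk : 1 ≤ k) :
    ∃ P, IsApprox1Start G k P := by
  have hne : {P | IsPartition G k P}.Nonempty := ⟨_, isPartition_singletons G hk⟩
  exact ⟨Function.argminOn numOneStars _ hne, Function.argminOn_mem _ _ hne,
    fun P' hP' => Function.argminOn_le numOneStars _ hP'⟩

theorem IsApprox1Start.step {P' : Finset (Star V)} (hk : 4 ≤ k) (h : IsApprox1Start G k P)
    (hs : Step G k P P') : IsApprox1Start G k P' :=
  have hi := hs.improves hk h.1
  ⟨hi.isPartition, fun P'' h'' => hi.numOneStars_le.trans (h.2 P'' h'')⟩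

theorem not_exists_infinite_run (hk : 4 ≤ k) :
    ¬ ∃ run : ℕ → Finset (Star V), IsApprox1Start G k (run 0) ∧
      ∀ i, Step G k (run i) (run (i + 1)) := by
  rintro ⟨run, h0, hs⟩
  have hstart : ∀ i, IsApprox1Start G k (run i) := fun i => by
    induction i with
    | zero => exact h0
    | succ i ih => exact ih.step hk (hs i)
  have hlt : ∀ i, Prod.Lex (· < ·) (· < ·) ((run (i + 1)).card, numTwoStars (run (i + 1)))
      ((run i).card, numTwoStars (run i)) := fun i => by
    rw [Prod.lex_def]
    rcases ((hs i).improves hk (hstart i).1).lex with h | ⟨h, h'⟩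
    · exact Or.inl h
    · rcases h.lt_or_eq with h | h
      exacts [Or.inl h, Or.inr ⟨h, h'⟩]
  have wf : WellFounded (Prod.Lex ((· < ·) : ℕ → ℕ → Prop) ((· < ·) : ℕ → ℕ → Prop)) :=
    WellFounded.prod_lex wellFounded_lt wellFounded_lt
  exact (wellFounded_iff_isEmpty_descending_chain.1 wf).false
    ⟨fun i => ((run i).card, numTwoStars (run i)), hlt⟩

theorem IsApprox1Output.isApprox1Start (hk : 4 ≤ k) (h : IsApprox1Output G k P) :
    IsApprox1Start G k P := by
  obtain ⟨P₀, h0, hr, -⟩ := h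
  induction hr with
  | refl => exact h0
  | tail _ hs ih => exact ih.step hk hs

/-! ### What a stuck partition excludes. -/

/-- `P` is a `k⁻`-star partition with the least number of `1`-stars, to which no operation is
applicable. -/
structure IsStuck (G : SimpleGraph V) (k : ℕ) (P : Finset (Star V)) : Prop where
  isStart : IsApprox1Start G k P
  not_step : ∀ P', ¬ Step G k P P'

namespace IsStuck

theorem isPartition (h : IsStuck G k P) : IsPartition G k P := h.isStart.1

/-- The vertices of a star of order `2`, `3` or `4` are not adjacent to separate critical
vertices outside. -/
theorem not_separate (h : IsStuck G k P) (hS : S ∈ P) (h2 : 2 ≤ S.order) (h4 : S.order ≤ 4)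
    (w : V → V) (hw : ∀ v ∈ S.verts, (h.isPartition.starAt (w v)).IsCriticalIn (w v) ∧
      h.isPartition.starAt (w v) ≠ S ∧ G.Adj v (w v))
    (hsep : ∀ v ∈ S.verts, ∀ v' ∈ S.verts, v ≠ v' →
      h.isPartition.starAt (w v) ≠ h.isPartition.starAt (w v')) : False :=
  h.not_step _ <| Or.inr <| Or.inl ⟨S, hS, w, fun v => h.isPartition.starAt (w v), h2, h4,
    fun v hv => ⟨h.isPartition.starAt_mem _, (hw v hv).1,
      fun hm => (hw v hv).2.1 (h.isPartition.starAt_eq hS hm), (hw v hv).2.2⟩, hsep, rfl⟩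

theorem not_separate_two (h : IsStuck G k P) {a b : V} (huv : u ≠ v)
    (h2 : (h.isPartition.starAt u).order = 2) (hv : v ∈ (h.isPartition.starAt u).verts)
    (ha : (h.isPartition.starAt a).IsCriticalIn a) (hb : (h.isPartition.starAt b).IsCriticalIn b)
    (hau : h.isPartition.starAt a ≠ h.isPartition.starAt u)
    (hbu : h.isPartition.starAt b ≠ h.isPartition.starAt u)
    (hab : h.isPartition.starAt a ≠ h.isPartition.starAt b)
    (hua : G.Adj u a) (hvb : G.Adj v b) : False := by
  have hverts : (h.isPartition.starAt u).verts = {u, v} := by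
    refine (Finset.eq_of_subset_of_card_le ?_ ?_).symm
    · simp [Finset.insert_subset_iff, hv, h.isPartition.mem_starAt]
    · rw [Finset.card_pair huv]; exact h2.le
  refine h.not_separate (h.isPartition.starAt_mem u) h2.ge (by omega)
    (fun x => if x = u then a else b) ?_ ?_
  · simp only [hverts, Finset.mem_insert, Finset.mem_singleton]
    rintro x (rfl | rfl)
    · simpa using ⟨ha, hau, hua⟩
    · simpa [huv.symm] using ⟨hb, hbu, hvb⟩
  · simp only [hverts, Finset.mem_insert, Finset.mem_singleton]
    rintro x (rfl | rfl) y (rfl | rfl) hne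
    · exact absurd rfl hne
    · simpa [huv.symm] using hab
    · simpa [huv.symm] using hab.symm
    · exact absurd rfl hne

/-- A vertex of a `2`-star is not adjacent to both vertices of another `2`-star. -/
theorem not_adj_two (h : IsStuck G k P) {x y : V} (hxy : x ≠ y)
    (hu : (h.isPartition.starAt u).order = 2) (hx : (h.isPartition.starAt x).order = 2)
    (hy : y ∈ (h.isPartition.starAt x).verts)
    (hne : h.isPartition.starAt u ≠ h.isPartition.starAt x) (hux : G.Adj u x) : ¬ G.Adj u y := by
  intro huy
  have hverts : (h.isPartition.starAt x).verts = {x, y} := by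
    refine (Finset.eq_of_subset_of_card_le ?_ ?_).symm
    · simp [Finset.insert_subset_iff, hy, h.isPartition.mem_starAt]
    · rw [Finset.card_pair hxy]; exact hx.le
  refine h.not_step _ <| Or.inr <| Or.inr ⟨_, h.isPartition.starAt_mem u, _,
    h.isPartition.starAt_mem x, u, hne, Or.inl hu, Or.inr ⟨hu, h.isPartition.mem_starAt u⟩, hx, ?_,
    Or.inl ⟨Or.inr hu, rfl⟩⟩
  simp [hverts, hux, huy]

/-- A `1`-star is only adjacent to centers of `k`-stars. -/
theorem of_adj_one (hk : 4 ≤ k) (h : IsStuck G k P) (hu : (h.isPartition.starAt u).order = 1)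
    (huv : G.Adj u v) : v = (h.isPartition.starAt v).center ∧
      (h.isPartition.starAt v).order = k := by
  by_contra hcon
  set U := h.isPartition.starAt u with hU
  set C := h.isPartition.starAt v with hC
  have hUP : U ∈ P := h.isPartition.starAt_mem u
  have hCP : C ∈ P := h.isPartition.starAt_mem v
  have hu' : u ∈ U.verts := h.isPartition.mem_starAt u
  have hv' : v ∈ C.verts := h.isPartition.mem_starAt v
  have hUu : U.verts = {u} := by
    obtain ⟨a, ha⟩ := Finset.card_eq_one.1 hu
    rw [ha, Finset.mem_singleton] at hu'
    rw [ha, hu']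
  have hUC : U ≠ C := by
    intro e
    rw [← e, hUu, Finset.mem_singleton] at hv'
    exact huv.ne hv'.symm
  have huC : u ∉ C.verts := Finset.disjoint_left.1 (h.isPartition.disjoint U hUP C hCP hUC) hu'
  have hsub : ({U, C} : Finset (Star V)) ⊆ P := by
    simp [Finset.insert_subset_iff, hUP, hCP]
  have hCk := h.isPartition.order_le C hCP
  have hCG := h.isPartition.isStarOf C hCP
  -- There is room at `v`: attaching `u` there would remove a 1-star.
  by_cases hc : C.IsCenter v ∧ C.order < k
  · have hord := Star.order_attach hv' huC
    have hpos := C.order_pos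
    have hpart : IsPartition G k (P \ {U, C} ∪ {C.attach v u}) := by
      refine h.isPartition.replace hsub ?_ ?_ ?_ ?_
      · simp only [Finset.mem_singleton, forall_eq]
        exact hCG.attach hc.1 huv.symm
      · simp only [Finset.mem_singleton, forall_eq]
        omega
      · simp only [Finset.mem_singleton]
        rintro _ rfl _ rfl hne
        exact absurd rfl hne
      · simp only [Finset.biUnion_insert, Finset.singleton_biUnion, Star.verts_attach hv', hUu]
        rfl
    refine absurd (h.isStart.2 _ hpart) (not_le.2 ?_)
    refine card_filter_replace_lt (fun T hT => ?_) (Finset.mem_insert_self U {C}) hUP hu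
    rw [Finset.mem_singleton.1 hT]
    omega
  -- Otherwise `v` is a satellite of a star of order at least 3. Pairing it with `u` leaves at least
  -- two vertices in `C`, so again a 1-star would be lost.
  · have hvc : v ≠ C.center := by
      intro e
      rcases hCk.lt_or_eq with hlt | heq
      exacts [hc ⟨Or.inl e, hlt⟩, hcon ⟨e, heq⟩]
    have hvs := Star.mem_satellites_of_ne_center hv' hvc
    have hord := hCG.order_detach hvs
    have hpos := (C.detach v).order_pos
    have h2 : C.order ≠ 2 := fun e => hc ⟨Or.inr ⟨e, hv'⟩, by omega⟩
    have hnew : (⟨v, {u}⟩ : Star V).verts = {v, u} := rfl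
    have hnewo : (⟨v, {u}⟩ : Star V).order = 2 := Finset.card_pair huv.ne'
    have hdis : Disjoint (⟨v, {u}⟩ : Star V).verts (C.detach v).verts := by
      rw [hCG.verts_detach hvs, hnew, Finset.disjoint_left]
      simp only [Finset.mem_insert, Finset.mem_singleton]
      rintro x (rfl | rfl)
      · simp
      · simp [huC]
    have hpart : IsPartition G k (P \ {U, C} ∪ {⟨v, {u}⟩, C.detach v}) := by
      refine h.isPartition.replace hsub ?_ ?_ ?_ ?_
      · simp only [Finset.mem_insert, Finset.mem_singleton]
        rintro _ (rfl | rfl)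
        · simpa [Star.IsStarOf] using huv.symm
        · exact hCG.detach
      · simp only [Finset.mem_insert, Finset.mem_singleton]
        rintro _ (rfl | rfl) <;> omega
      · simp only [Finset.mem_insert, Finset.mem_singleton]
        rintro _ (rfl | rfl) _ (rfl | rfl) hne
        exacts [absurd rfl hne, hdis, hdis.symm, absurd rfl hne]
      · simp only [Finset.biUnion_insert, Finset.singleton_biUnion, hCG.verts_detach hvs, hUu, hnew]
        ext x
        simp only [Finset.mem_union, Finset.mem_insert, Finset.mem_singleton, Finset.mem_erase]
        by_cases hx : x = v
        · subst hx; simp [hv']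
        · simp [hx]
    refine absurd (h.isStart.2 _ hpart) (not_le.2 ?_)
    refine card_filter_replace_lt (fun T hT => ?_) (Finset.mem_insert_self U {C}) hUP hu
    simp only [Finset.mem_insert, Finset.mem_singleton] at hT
    rcases hT with rfl | rfl <;> omega

end IsStuck

theorem IsApprox1Output.isStuck (hk : 4 ≤ k) (h : IsApprox1Output G k P) : IsStuck G k P :=
  ⟨h.isApprox1Start hk, by obtain ⟨_, _, _, h'⟩ := h; exact h'⟩

/-! ### The charging scheme. -/

/-- The stars of order `k` with all vertices in `2`-stars of the other collection. -/
def IsBad (k : ℕ) (p : V → Star V) (T : Star V) : Prop :=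
  T.order = k ∧ ∀ v ∈ T.verts, (p v).order = 2

/-- The vertices of `3⁺`-stars that are not critical. -/
def IsStrong (p : V → Star V) (v : V) : Prop := 3 ≤ (p v).order ∧ ¬ (p v).IsCriticalIn v

/-- `x` is a satellite of a bad star and lies in a `2`-star, whose other vertex `v` is not the
center of the bad star. -/
def IsLinkSource (k : ℕ) (p q : V → Star V) (x v : V) : Prop :=
  IsBad k p (q x) ∧ x ≠ (q x).center ∧ x ≠ v ∧ v ∈ (p x).verts ∧ v ≠ (q x).center

/-- The vertices with a link. -/
def IsSource (k : ℕ) (p q : V → Star V) (x : V) : Prop := ∃ v, IsLinkSource k p q x v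

/-- The `2`-star neighbours of satellites of bad stars. -/
def IsLink (k : ℕ) (p q : V → Star V) (v : V) : Prop := ∃ x, IsLinkSource k p q x v

/-- The centers of `3`-stars that lie in a small star of the other collection or are joined there
to noncritical vertices only. -/
def IsSpare (k : ℕ) (p q : V → Star V) (z : V) : Prop :=
  (p z).order = 3 ∧ z = (p z).center ∧ ((q z).order < k ∨ ∀ w ∈ (q z).verts, w ≠ z →
    (z = (q z).center ∨ w = (q z).center) → ¬ (p w).IsCriticalIn w)

/-- The vertices that a star of the other collection has to pay for. -/
def IsLoad (k : ℕ) (p q : V → Star V) (v : V) : Prop := IsLink k p q v ∨ IsSpare k p q v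

open Classical in
/-- The number of vertices of a star that it has to pay for. -/
noncomputable def loadCount (k : ℕ) (p q : V → Star V) (T : Star V) : ℕ :=
  (T.verts.filter (IsLoad k p q)).card

open Classical in
/-- The number of vertices to be paid for in the `k`-star with center `v`, if there is one. -/
noncomputable def load (k : ℕ) (p q : V → Star V) (v : V) : ℕ :=
  if v = (q v).center ∧ (q v).order = k then loadCount k p q (q v) else 0

open Classical in
/-- The charge that a vertex receives from its star in the first collection. -/
noncomputable def income (k : ℕ) (p q : V → Star V) (v : V) : ℤ :=
  if IsStrong p v then k - 2 + load k p q v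
  else if (p v).order = 3 then (if IsSpare k p q v then -1 else k - 2) else 0

/-- The stars `p v` of a stuck partition and `q v` of another partition at the vertices `v`, and
what is used about them. -/
structure Config (G : SimpleGraph V) (k : ℕ) (p q : V → Star V) : Prop where
  four_le : 4 ≤ k
  mem_p : ∀ v, v ∈ (p v).verts
  eq_p : ∀ {u v}, v ∈ (p u).verts → p v = p u
  star_p : ∀ v, (p v).IsStarOf G
  mem_q : ∀ v, v ∈ (q v).verts
  eq_q : ∀ {u v}, v ∈ (q u).verts → q v = q u
  star_q : ∀ v, (q v).IsStarOf G
  q_le : ∀ v, (q v).order ≤ k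
  not_separate : ∀ u, 2 ≤ (p u).order → (p u).order ≤ 4 → ∀ w : V → V,
    (∀ v ∈ (p u).verts, (p (w v)).IsCriticalIn (w v) ∧ p (w v) ≠ p u ∧ G.Adj v (w v)) →
    (∀ v ∈ (p u).verts, ∀ v' ∈ (p u).verts, v ≠ v' → p (w v) ≠ p (w v')) → False
  not_separate_two : ∀ {u v a b}, u ≠ v → (p u).order = 2 → v ∈ (p u).verts →
    (p a).IsCriticalIn a → (p b).IsCriticalIn b → p a ≠ p u → p b ≠ p u → p a ≠ p b →
    G.Adj u a → G.Adj v b → False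
  not_adj_two : ∀ {u x y}, x ≠ y → (p u).order = 2 → (p x).order = 2 → y ∈ (p x).verts →
    p u ≠ p x → G.Adj u x → ¬ G.Adj u y
  of_adj_one : ∀ {u v}, (p u).order = 1 → G.Adj u v → v = (p v).center ∧ (p v).order = k

theorem IsStuck.config (hk : 4 ≤ k) (h : IsStuck G k P) (hQ : IsPartition G k Q) :
    Config G k h.isPartition.starAt hQ.starAt where
  four_le := hk
  mem_p := h.isPartition.mem_starAt
  eq_p := h.isPartition.starAt_eq (h.isPartition.starAt_mem _)
  star_p v := h.isPartition.isStarOf _ (h.isPartition.starAt_mem v)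
  mem_q := hQ.mem_starAt
  eq_q := hQ.starAt_eq (hQ.starAt_mem _)
  star_q v := hQ.isStarOf _ (hQ.starAt_mem v)
  q_le v := hQ.order_le _ (hQ.starAt_mem v)
  not_separate u := h.not_separate (h.isPartition.starAt_mem u)
  not_separate_two := h.not_separate_two
  not_adj_two := h.not_adj_two
  of_adj_one := h.of_adj_one hk

theorem Star.eq_or_eq_of_order_eq_two {a b x : V} (h2 : S.order = 2) (hab : a ≠ b)
    (ha : a ∈ S.verts) (hb : b ∈ S.verts) (hx : x ∈ S.verts) : x = a ∨ x = b := by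
  by_contra hcon
  rw [not_or] at hcon
  have hsub : ({x, a, b} : Finset V) ⊆ S.verts := by
    simp [Finset.insert_subset_iff, ha, hb, hx]
  have := Finset.card_le_card hsub
  rw [Finset.card_eq_three.2 ⟨x, a, b, hcon.1, hcon.2, hab, rfl⟩] at this
  have : S.order = S.verts.card := rfl
  omega

theorem Star.exists_ne_of_order_eq_two (h2 : S.order = 2) (v : V) : ∃ w ∈ S.verts, w ≠ v :=
  Finset.exists_mem_ne (by rw [← Star.order]; omega) v

theorem Star.IsCriticalIn.eq_center (h : S.IsCriticalIn v) (h3 : S.order = 3) : v = S.center :=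
  by_contra fun hc => h.2.2 ⟨h3, Star.mem_satellites_of_ne_center h.2.1 hc⟩

namespace Config

theorem isCriticalIn_of_two (_ : Config G k p q) (hv : (p v).order = 2) (hm : v ∈ (p v).verts) :
    (p v).IsCriticalIn v :=
  ⟨Or.inl hv, hm, fun h => by omega⟩

theorem adj_center (c : Config G k p q) (hv : v ≠ (q v).center) : G.Adj (q v).center v :=
  c.star_q v v (Star.mem_satellites_of_ne_center (c.mem_q v) hv)

theorem q_center (c : Config G k p q) (v : V) : q (q v).center = q v :=
  c.eq_q (Star.center_mem_verts _)

theorem q_satellite (c : Config G k p q) (h : v ∈ (q u).satellites) : q v = q u :=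
  c.eq_q (Star.mem_verts_of_mem_satellites h)

/-- A noncritical vertex adjacent to a vertex that is not the center of a `k`-star. -/
theorem isStrong_of_adj (c : Config G k p q) (hu : (p u).order ≠ k) (huv : G.Adj u v)
    (hv : ¬ (p v).IsCriticalIn v) : IsStrong p v := by
  -- If `v` were a 1-star, its neighbor `u` would be the center of a `k`-star.
  refine ⟨?_, hv⟩
  have h1 : (p v).order ≠ 1 := fun e => hu (c.of_adj_one e huv.symm).2
  have h2 : (p v).order ≠ 2 := fun e => hv (c.isCriticalIn_of_two e (c.mem_p v))
  have := (p v).order_pos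
  omega

theorem isStrong_of_four_le (_ : Config G k p q) (h : 4 ≤ (p v).order) : IsStrong p v :=
  ⟨by omega, fun hc => by have := hc.1; unfold Star.IsTiny at this; omega⟩

/-! ### Links of bad stars. -/

section Link

variable {x : V}

theorem link_order (_ : Config G k p q) (h : IsLinkSource k p q x v) (hx : x ∈ (q x).verts) :
    (p x).order = 2 := h.1.2 x hx

theorem link_eq (c : Config G k p q) (h : IsLinkSource k p q x v) : p v = p x := c.eq_p h.2.2.2.1

theorem link_center_order (_ : Config G k p q) (h : IsLinkSource k p q x v) :
    (p (q x).center).order = 2 := h.1.2 _ (Star.center_mem_verts _)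

theorem link_center_ne (c : Config G k p q) (h : IsLinkSource k p q x v) :
    p (q x).center ≠ p x := by
  intro e
  have hm := c.mem_p (q x).center
  rw [e] at hm
  rcases Star.eq_or_eq_of_order_eq_two (c.link_order h (c.mem_q x)) h.2.2.1 (c.mem_p x)
    h.2.2.2.1 hm with e | e
  exacts [h.2.1 e.symm, h.2.2.2.2 e.symm]

/-- Otherwise the center of the bad star, itself in a 2-star, would be adjacent to both vertices of
the 2-star on `x` and `v`, and Operation 3 would apply. -/
theorem link_q_ne (c : Config G k p q) (h : IsLinkSource k p q x v) : q v ≠ q x := by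
  intro e
  have h1 := c.adj_center h.2.1
  have h2 := c.adj_center (v := v) (by rw [e]; exact h.2.2.2.2)
  rw [e] at h2
  exact c.not_adj_two h.2.2.1 (c.link_center_order h) (c.link_order h (c.mem_q x)) h.2.2.2.1
    (c.link_center_ne h) h1 h2

/-- The vertex `x` is adjacent to the critical center of its bad star. So Operation 2 on the 2-star
of `x` and `v` is blocked only if `v` has no critical neighbor separate from that center and outside
this 2-star. This makes the neighbors of `v` in its own star of the other collection strong, up to
the partner of the bad center. -/
theorem link_center (c : Config G k p q) (h : IsLinkSource k p q x v) :
    IsStrong p (q v).center ∨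
      (q v).center = v ∧ ∃ e, ∀ y ∈ (q v).satellites, y ≠ e → IsStrong p y := by
  have hk := c.four_le
  have hx2 := c.link_order h (c.mem_q x)
  have hpv := c.link_eq h
  have hv2 : (p v).order = 2 := by rw [hpv, hx2]
  have hxv : x ∈ (p v).verts := by rw [hpv]; exact c.mem_p x
  have hc2 := c.link_center_order h
  have hcx := c.link_center_ne h
  have hcv : p (q x).center ≠ p v := by rw [hpv]; exact hcx
  have hqv := c.link_q_ne h
  have hccrit := c.isCriticalIn_of_two hc2 (c.mem_p _)
  have hadj := c.adj_center h.2.1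
  have hne : ∀ y, q y = q v → y ≠ v → p y ≠ p v := by
    intro y hy hyv e
    have hm := c.mem_p y
    rw [e] at hm
    rcases Star.eq_or_eq_of_order_eq_two hv2 h.2.2.1 hxv (c.mem_p v) hm with rfl | e
    exacts [hqv hy.symm, hyv e]
  by_cases hd : (q v).center = v
  · refine Or.inr ⟨hd, ?_⟩
    obtain ⟨e, he, hec⟩ := Star.exists_ne_of_order_eq_two hc2 (q x).center
    refine ⟨e, fun y hy hye => ?_⟩
    have hvy : G.Adj v y := by
      have := c.star_q v y hy
      rwa [hd] at this
    refine c.isStrong_of_adj (by omega) hvy fun hcrit => ?_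
    have hqy := c.q_satellite hy
    refine c.not_separate_two h.2.2.1.symm hv2 hxv hcrit hccrit
      (hne y hqy hvy.ne') hcv ?_ hvy hadj.symm
    intro e'
    have hm := c.mem_p y
    rw [e'] at hm
    rcases Star.eq_or_eq_of_order_eq_two hc2 hec he (c.mem_p _) hm with e | rfl
    · exact hye e
    · rw [c.q_center] at hqy
      exact hqv hqy.symm
  · refine Or.inl ?_
    have hvd := c.adj_center (v := v) (Ne.symm hd)
    refine c.isStrong_of_adj (by omega) hvd.symm fun hcrit => ?_
    have hdv := hne _ (c.q_center v) hd
    -- If the center of `q v` is the partner of the bad center, Operation 2 is used on their common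
    -- 2-star instead: the bad center goes to a second satellite `y`, its partner to `v`.
    by_cases hdc : p (q v).center = p (q x).center
    · have hcd : (q x).center ≠ (q v).center := by
        intro e
        have := c.q_center v
        rw [← e, c.q_center] at this
        exact hqv this.symm
      have hdm : (q v).center ∈ (p (q x).center).verts := by
        rw [← hdc]; exact c.mem_p _
      have hcard := (c.star_q x).card_satellites
      rw [h.1.1] at hcard
      obtain ⟨y, hy, hyx⟩ := Finset.exists_mem_ne (s := (q x).satellites) (by omega) x
      have hqy := c.q_satellite hy
      have hy2 := h.1.2 y (Star.mem_verts_of_mem_satellites hy)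
      have hcy := c.star_q x y hy
      refine c.not_separate_two hcd hc2 hdm (c.isCriticalIn_of_two hy2 (c.mem_p y))
        (c.isCriticalIn_of_two hv2 (c.mem_p v)) ?_ hcv.symm ?_ hcy hvd
      · intro e
        have hm := c.mem_p y
        rw [e] at hm
        rcases Star.eq_or_eq_of_order_eq_two hc2 hcd (c.mem_p _) hdm hm with e | e
        · exact hcy.ne' e
        · rw [e, c.q_center] at hqy
          exact hqv hqy
      · intro e
        have hm := c.mem_p y
        rw [e] at hm
        rcases Star.eq_or_eq_of_order_eq_two hv2 h.2.2.1 hxv (c.mem_p v) hm with e | rfl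
        · exact hyx e
        · exact hqv hqy
    · exact c.not_separate_two h.2.2.1.symm hv2 hxv hcrit hccrit hdv hcv hdc hvd.symm hadj.symm

end Link

/-! ### Loads as separate critical vertices. -/

theorem order_of_isLink (c : Config G k p q) (h : IsLink k p q v) : (p v).order = 2 := by
  obtain ⟨x, hx⟩ := h
  rw [c.link_eq hx]
  exact c.link_order hx (c.mem_q x)

theorem isCriticalIn_of_isLoad (c : Config G k p q) (h : IsLoad k p q v) :
    (p v).IsCriticalIn v := by
  rcases h with h | ⟨h3, hv, -⟩
  · exact c.isCriticalIn_of_two (c.order_of_isLink h) (c.mem_p v)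
  · exact ⟨Or.inr h3, c.mem_p v, fun hs => (c.star_p v).ne_center hs.2 hv⟩

/-- Outside bad stars, a vertex to be paid for is the only critical vertex of its star. -/
theorem eq_of_isLoad (c : Config G k p q) {a : V} (ha : IsLoad k p q a)
    (hw : (p w).IsCriticalIn w) (hpw : p w = p a) (hqw : ¬ IsBad k p (q w)) : w = a := by
  have hac := c.isCriticalIn_of_isLoad ha
  have hwm := c.mem_p w
  rw [hpw] at hw hwm
  rcases ha with ⟨x, hx⟩ | ⟨h3, -, -⟩
  · have hpa := c.link_eq hx
    rw [hpa] at hwm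
    rcases Star.eq_or_eq_of_order_eq_two (c.link_order hx (c.mem_q x)) hx.2.2.1 (c.mem_p x)
      hx.2.2.2.1 hwm with rfl | e
    exacts [absurd hx.1 hqw, e]
  · rw [hw.eq_center h3, ← hac.eq_center h3]

theorem not_isBad (c : Config G k p q) (hv : (p v).order ≠ 2) : ¬ IsBad k p (q v) :=
  fun h => hv (h.2 v (c.mem_q v))

theorem exists_isLoad (c : Config G k p q) (hv : IsStrong p v) (hl : load k p q v ≠ 0) :
    v = (q v).center ∧ ∃ a, IsLoad k p q a ∧ q a = q v ∧ G.Adj v a := by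
  classical
  unfold load at hl
  split_ifs at hl with h
  · refine ⟨h.1, ?_⟩
    obtain ⟨a, ha⟩ := Finset.card_pos.1 (Nat.pos_of_ne_zero hl)
    rw [Finset.mem_filter] at ha
    have hqa := c.eq_q ha.1
    have hav : a ≠ v := fun e => hv.2 (e ▸ c.isCriticalIn_of_isLoad ha.2)
    refine ⟨a, ha.2, hqa, ?_⟩
    have := c.adj_center (v := a) (by rw [hqa, ← h.1]; exact hav)
    rwa [hqa, ← h.1] at this
  · exact absurd rfl hl

theorem load_le (c : Config G k p q) (hv : IsStrong p v) : load k p q v + 1 ≤ k := by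
  classical
  have hk := c.four_le
  unfold load
  split_ifs with h
  · have hcard : ((q v).verts.erase v).card + 1 = (q v).order :=
      Finset.card_erase_add_one (c.mem_q v)
    suffices loadCount k p q (q v) ≤ ((q v).verts.erase v).card by omega
    refine Finset.card_le_card fun a ha => ?_
    rw [Finset.mem_filter] at ha
    rw [Finset.mem_erase]
    exact ⟨fun e => hv.2 (e ▸ c.isCriticalIn_of_isLoad ha.2), ha.1⟩
  · omega

/-- Different vertices have separate vertices to be paid for. -/
theorem p_ne_of_isLoad (c : Config G k p q) {a b : V} (hu : u = (q u).center)
    (hv : v = (q v).center) (huv : u ≠ v) (hu3 : (p u).order ≠ 2) (ha : IsLoad k p q a)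
    (hb : IsLoad k p q b) (hqa : q a = q u) (hqb : q b = q v) : p a ≠ p b := by
  intro e
  have := c.eq_of_isLoad hb (c.isCriticalIn_of_isLoad ha) e (by rw [hqa]; exact c.not_isBad hu3)
  subst this
  exact huv (by rw [hu, hv, ← hqa, ← hqb])

/-- If all four vertices had a load, each would be a center in the other collection with a critical
neighbor to be paid for. These neighbors are separate, so Operation 2 would apply. -/
theorem exists_load_eq_zero_of_four (c : Config G k p q) (hu : (p u).order = 4) :
    ∃ v ∈ (p u).verts, load k p q v = 0 := by
  by_contra! hcon
  have hs : ∀ v ∈ (p u).verts, IsStrong p v := fun v hv =>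
    c.isStrong_of_four_le (by rw [c.eq_p hv]; omega)
  choose! hcen a ha using fun v hv => c.exists_isLoad (hs v hv) (hcon v hv)
  refine c.not_separate u (by omega) (by omega) a (fun v hv => ?_) fun v hv v' hv' hne => ?_
  · have hcrit := c.isCriticalIn_of_isLoad (ha v hv).1
    refine ⟨hcrit, fun e => ?_, (ha v hv).2.2⟩
    have := hcrit.1
    rw [e] at this
    unfold Star.IsTiny at this
    omega
  · refine c.p_ne_of_isLoad (hcen v hv) (hcen v' hv') hne ?_ (ha v hv).1 (ha v' hv').1
      (ha v hv).2.1 (ha v' hv').2.1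
    rw [c.eq_p hv]
    omega

theorem isStrong_of_three (c : Config G k p q) (hu : (p u).order = 3)
    (hv : v ∈ (p u).satellites) : IsStrong p v := by
  have e := c.eq_p (Star.mem_verts_of_mem_satellites hv)
  refine ⟨by rw [e]; omega, fun hc => ?_⟩
  rw [e] at hc
  exact hc.2.2 ⟨hu, hv⟩

/-- Since `u` is not spare, it has a critical neighbor `w`. If both satellites had a load, `w` and
one load of each satellite would be separate, and Operation 2 would apply to the 3-star. -/
theorem exists_load_eq_zero_of_three (c : Config G k p q) (hu : (p u).order = 3)
    (huc : u = (p u).center) (hsp : ¬ IsSpare k p q u) :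
    ∃ v ∈ (p u).satellites, load k p q v = 0 := by
  by_contra! hcon
  have hs : ∀ v ∈ (p u).satellites, IsStrong p v := fun v hv => c.isStrong_of_three hu hv
  choose! hcen a ha using fun v hv => c.exists_isLoad (hs v hv) (hcon v hv)
  obtain ⟨-, w, hw, hwu, hwc, hcrit⟩ : (q u).order ≥ k ∧ ∃ w ∈ (q u).verts, w ≠ u ∧
      (u = (q u).center ∨ w = (q u).center) ∧ (p w).IsCriticalIn w := by
    unfold IsSpare at hsp
    push Not at hsp
    exact hsp hu huc
  have hqw := c.eq_q hw
  have huw : G.Adj u w := by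
    rcases hwc with e | e
    · have := c.adj_center (v := w) (by rw [hqw, ← e]; exact hwu)
      rwa [hqw, ← e] at this
    · have := c.adj_center (v := u) (by rw [← e]; exact hwu.symm)
      rw [← e] at this
      exact this.symm
  have hsat : ∀ v ∈ (p u).verts, v ≠ u → v ∈ (p u).satellites := fun v hv hvu =>
    Star.mem_satellites_of_ne_center hv (by rw [← huc]; exact hvu)
  have hpv : ∀ v ∈ (p u).satellites, p v = p u := fun v hv =>
    c.eq_p (Star.mem_verts_of_mem_satellites hv)
  have heq : ∀ y, (p y).IsCriticalIn y → p y = p u → y = u := fun y hy e => by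
    rw [e] at hy
    rw [hy.eq_center hu, ← huc]
  have hwa : ∀ v ∈ (p u).satellites, p w ≠ p (a v) := by
    intro v hv e
    have := c.eq_of_isLoad (ha v hv).1 hcrit e (by rw [hqw]; exact c.not_isBad (by omega))
    have hq : q u = q v := by rw [← (ha v hv).2.1, ← this, hqw]
    have huv : u ≠ v := by
      rintro rfl
      exact (c.star_p u).ne_center hv huc
    have hwv : w = v := by
      rcases hwc with e | e
      · exact absurd (e.trans (by rw [hq, ← hcen v hv])) huv
      · rw [e, hq, ← hcen v hv]
    exact (hs v hv).2 (hwv ▸ hcrit)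
  refine c.not_separate u (by omega) (by omega) (fun v => if v = u then w else a v)
    (fun v hv => ?_) fun v hv v' hv' hne => ?_
  · by_cases hvu : v = u
    · subst hvu
      rw [if_pos rfl]
      exact ⟨hcrit, fun e => hwu (heq w hcrit e), huw⟩
    · rw [if_neg hvu]
      have hv := hsat v hv hvu
      have hcr := c.isCriticalIn_of_isLoad (ha v hv).1
      refine ⟨hcr, fun e => ?_, (ha v hv).2.2⟩
      have hau := heq _ hcr e
      have hload := (ha v hv).1
      rw [hau] at hload
      rcases hload with hload | hload
      · have := c.order_of_isLink hload
        omega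
      · exact hsp hload
  · by_cases hvu : v = u
    · rw [if_pos hvu, if_neg (fun e => hne (hvu.trans e.symm))]
      exact hwa v' (hsat v' hv' fun e => hne (hvu.trans e.symm))
    · rw [if_neg hvu]
      have hv := hsat v hv hvu
      by_cases hvu' : v' = u
      · rw [if_pos hvu']
        exact (hwa v hv).symm
      · rw [if_neg hvu']
        have hv' := hsat v' hv' hvu'
        refine c.p_ne_of_isLoad (hcen v hv) (hcen v' hv') hne ?_ (ha v hv).1 (ha v' hv').1
          (ha v hv).2.1 (ha v' hv').2.1
        rw [hpv v hv]
        omega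

/-! ### What a star of the first collection gives. -/

theorem income_of_isStrong (hv : IsStrong p v) :
    income k p q v = k - 2 + load k p q v := if_pos hv

theorem income_of_order_le_two (hv : (p v).order ≤ 2) : income k p q v = 0 := by
  rw [income, if_neg fun h => by have := h.1; omega, if_neg (by omega)]

theorem income_of_isSpare (c : Config G k p q) (hv : IsSpare k p q v) :
    income k p q v = -1 := by
  rw [income, if_neg fun h => h.2 (c.isCriticalIn_of_isLoad (Or.inr hv)), if_pos hv.1, if_pos hv]

theorem income_of_three (hv : ¬ IsStrong p v) (h3 : (p v).order = 3) (hs : ¬ IsSpare k p q v) :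
    income k p q v = k - 2 := by
  rw [income, if_neg hv, if_pos h3, if_neg hs]

/-- What the vertices of a star receive is bounded by what the star has to give. -/
theorem sum_income_le (c : Config G k p q) (u : V) :
    ∑ v ∈ (p u).verts, income k p q v ≤ (4 * k - 7) * (((p u).order - 2 : ℕ) : ℤ) := by
  have hk : (4 : ℤ) ≤ k := by exact_mod_cast c.four_le
  have hpv : ∀ v ∈ (p u).verts, p v = p u := fun v hv => c.eq_p hv
  have hle : ∀ v, IsStrong p v → income k p q v ≤ 2 * k - 3 := fun v hv => by
    have := c.load_le hv
    rw [income_of_isStrong hv]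
    omega
  have hcard : (p u).verts.card = (p u).order := rfl
  -- The crude bound 2k-3 per vertex suffices from order 5 on. At order 4 it exceeds the budget
  -- 8k-14, so a vertex without load is needed.
  obtain h | h | h | h : (p u).order ≤ 2 ∨ (p u).order = 3 ∨ (p u).order = 4 ∨
      5 ≤ (p u).order := by omega
  · rw [Finset.sum_eq_zero fun v hv => income_of_order_le_two (by rw [hpv v hv]; exact h),
      Nat.sub_eq_zero_of_le h]
    simp
  · have hsc := (c.star_p u).card_satellites
    rw [Star.verts, Finset.sum_insert (c.star_p u).center_notMem, h]
    set z := (p u).center with hz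
    have hzu : p z = p u := hpv z (Star.center_mem_verts _)
    have hz3 : (p z).order = 3 := by rw [hzu, h]
    have hzc : z = (p z).center := by rw [hzu]
    have hzs : ¬ IsStrong p z := fun hs => hs.2
      ⟨Or.inr hz3, c.mem_p z, fun hm => (c.star_p z).ne_center hm.2 hzc⟩
    have hs : ∀ v ∈ (p u).satellites, IsStrong p v := fun v hv => c.isStrong_of_three h hv
    -- Both cases can exhaust the budget 4k-7: it equals -1 + 2(2k-3), and also 2(k-2) + (2k-3).
    by_cases hsp : IsSpare k p q z
    · rw [c.income_of_isSpare hsp]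
      have := Finset.sum_le_card_nsmul (p u).satellites (income k p q) (2 * k - 3)
        fun v hv => hle v (hs v hv)
      rw [show (p u).satellites.card = 2 by omega] at this
      simp only [nsmul_eq_mul] at this
      push_cast at this ⊢
      linarith
    · rw [income_of_three hzs hz3 hsp]
      obtain ⟨y, hy, hy0⟩ := c.exists_load_eq_zero_of_three hz3 hzc hsp
      rw [hzu] at hy
      rw [← Finset.add_sum_erase _ _ hy, income_of_isStrong (hs y hy), hy0]
      have := Finset.sum_le_card_nsmul ((p u).satellites.erase y) (income k p q) (2 * k - 3)
        fun v hv => hle v (hs v (Finset.mem_of_mem_erase hv))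
      rw [Finset.card_erase_of_mem hy, show (p u).satellites.card = 2 by omega] at this
      simp only [nsmul_eq_mul] at this
      push_cast at this ⊢
      linarith
  · have hs : ∀ v ∈ (p u).verts, IsStrong p v := fun v hv =>
      c.isStrong_of_four_le (by rw [hpv v hv]; omega)
    obtain ⟨y, hy, hy0⟩ := c.exists_load_eq_zero_of_four h
    rw [← Finset.add_sum_erase _ _ hy, income_of_isStrong (hs y hy), hy0]
    have := Finset.sum_le_card_nsmul ((p u).verts.erase y) (income k p q) (2 * k - 3)
      fun v hv => hle v (hs v (Finset.mem_of_mem_erase hv))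
    rw [Finset.card_erase_of_mem hy, hcard, h] at this
    simp only [nsmul_eq_mul] at this
    rw [h]
    push_cast at this ⊢
    linarith
  · have := Finset.sum_le_card_nsmul (p u).verts (income k p q) (2 * k - 3)
      fun v hv => hle v (c.isStrong_of_four_le (by rw [hpv v hv]; omega))
    rw [hcard, nsmul_eq_mul] at this
    rw [Nat.cast_sub (by omega)]
    have h5 : (5 : ℤ) ≤ (p u).order := by exact_mod_cast h
    push_cast
    nlinarith

/-! ### What a star of the other collection pays. -/

theorem loadCount_le_order : loadCount k p q T ≤ T.order := by
  classical
  exact Finset.card_filter_le _ _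

theorem loadCount_le_sum (_ : Config G k p q) {A : Finset V}
    (hA : ∀ v ∈ T.verts, IsLoad k p q v → v ∈ A) : loadCount k p q T ≤ A.card := by
  classical
  refine Finset.card_le_card fun v hv => ?_
  rw [Finset.mem_filter] at hv
  exact hA v hv.1 hv.2

open Classical in
/-- The income of a vertex without what it has to return. -/
noncomputable def gross (k : ℕ) (p q : V → Star V) (v : V) : ℤ :=
  income k p q v + if IsSpare k p q v then 1 else 0

theorem gross_nonneg (c : Config G k p q) (v : V) : 0 ≤ gross k p q v := by
  have hk : (4 : ℤ) ≤ k := by exact_mod_cast c.four_le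
  unfold gross
  by_cases hs : IsSpare k p q v
  · rw [c.income_of_isSpare hs, if_pos hs]
    norm_num
  · rw [if_neg hs, income, if_neg hs]
    split_ifs <;> linarith [Int.natCast_nonneg (load k p q v)]

theorem gross_of_isStrong (c : Config G k p q) (hv : IsStrong p v) :
    gross k p q v = k - 2 + load k p q v := by
  rw [gross, if_neg fun h => hv.2 (c.isCriticalIn_of_isLoad (Or.inr h)), add_zero,
    income_of_isStrong hv]

theorem le_gross_of_isStrong (c : Config G k p q) (hv : IsStrong p v) :
    (k : ℤ) - 2 ≤ gross k p q v := by
  rw [c.gross_of_isStrong hv]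
  linarith [Int.natCast_nonneg (load k p q v)]

theorem gross_of_three (hv : ¬ IsStrong p v) (h3 : (p v).order = 3) (hs : ¬ IsSpare k p q v) :
    gross k p q v = k - 2 := by
  rw [gross, if_neg hs, add_zero, income_of_three hv h3 hs]

theorem le_sum_gross (c : Config G k p q) (hv : v ∈ T.verts) :
    gross k p q v ≤ ∑ v ∈ T.verts, gross k p q v :=
  Finset.single_le_sum (f := gross k p q) (fun v _ => c.gross_nonneg v) hv

theorem mul_le_sum_gross (c : Config G k p q) {A : Finset V} (hA : A ⊆ T.verts)
    (hs : ∀ v ∈ A, IsStrong p v) :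
    (A.card : ℤ) * (k - 2) ≤ ∑ v ∈ T.verts, gross k p q v := by
  rw [← nsmul_eq_mul]
  exact (Finset.card_nsmul_le_sum A _ _ fun v hv => c.le_gross_of_isStrong (hs v hv)).trans
    (Finset.sum_le_sum_of_subset_of_nonneg hA fun v _ _ => c.gross_nonneg v)

open Classical in
/-- A star of order `k` of the other collection can pay what it has to. -/
theorem le_sum_gross_of_order_eq (c : Config G k p q) (hu : (q u).order = k) :
    (k : ℤ) - 2 + loadCount k p q (q u) ≤
      ∑ v ∈ (q u).verts, gross k p q v + if IsBad k p (q u) then (k : ℤ) - 2 else 0 := by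
  have hk := c.four_le
  have hkz : (4 : ℤ) ≤ k := by exact_mod_cast hk
  have hbad : (0 : ℤ) ≤ if IsBad k p (q u) then (k : ℤ) - 2 else 0 := by
    split_ifs <;> linarith
  have hcard := (c.star_q u).card_satellites
  have hload : loadCount k p q (q u) ≤ k := loadCount_le_order.trans hu.le
  -- This amounts to (k-1)(k-2) ≥ (k-2) + k, that is (k-1)(k-4) ≥ 0, with equality at k = 4.
  have hall : (∀ y ∈ (q u).satellites, IsStrong p y) →
      (k : ℤ) - 2 + loadCount k p q (q u) ≤ ∑ v ∈ (q u).verts, gross k p q v := by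
    intro hs
    have h1 := c.mul_le_sum_gross (T := q u) (Finset.subset_insert _ _) hs
    have h2 : ((q u).satellites.card : ℤ) = k - 1 := by omega
    have h3 : (loadCount k p q (q u) : ℤ) ≤ k := by exact_mod_cast hload
    rw [h2] at h1
    nlinarith
  set d := (q u).center with hd
  have hdm : d ∈ (q u).verts := Star.center_mem_verts _
  have hqd : q d = q u := c.eq_q hdm
  have hadj : ∀ y ∈ (q u).satellites, G.Adj d y := fun y hy => c.star_q u y hy
  have hlink : ∀ v ∈ (q u).verts, IsLink k p q v → IsStrong p d ∨
      d = v ∧ ∃ e, ∀ y ∈ (q u).satellites, y ≠ e → IsStrong p y := by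
    rintro v hv ⟨x, hx⟩
    have := c.link_center hx
    rwa [c.eq_q hv] at this
  have hspare : ∀ v ∈ (q u).verts, v ≠ d → IsSpare k p q v → ¬ (p d).IsCriticalIn d := by
    rintro v hv hvd ⟨-, -, h | h⟩
    · rw [c.eq_q hv] at h
      omega
    · rw [c.eq_q hv] at h
      exact h d hdm hvd.symm (Or.inr rfl)
  by_cases hds : IsStrong p d
  · have h1 := c.le_sum_gross hdm
    rw [c.gross_of_isStrong hds, load, if_pos ⟨by rw [hqd], by rw [hqd, hu]⟩, hqd] at h1
    linarith
  have hdpos := (p d).order_pos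
  obtain h | h | h | h : (p d).order = 1 ∨ (p d).order = 2 ∨ (p d).order = 3 ∨
      4 ≤ (p d).order := by omega
  · refine (hall fun y hy => c.isStrong_of_four_le ?_).trans (by linarith)
    rw [(c.of_adj_one h (hadj y hy)).2]
    exact hk
  · have hcrit := c.isCriticalIn_of_two h (c.mem_p d)
    -- A critical `d` excludes spare satellites, and a link in a star without strong center is the
    -- center.
    have hloads : ∀ v ∈ (q u).verts, IsLoad k p q v → v ∈ ({d} : Finset V) := by
      intro v hv hl
      rw [Finset.mem_singleton]
      rcases hl with hl | hl
      · exact ((hlink v hv hl).resolve_left hds).1.symm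
      · by_contra hvd
        exact hspare v hv hvd hl hcrit
    by_cases hdl : IsLoad k p q d
    · have hdl' : IsLink k p q d := hdl.resolve_right fun hs => by have := hs.1; omega
      obtain ⟨-, e, he⟩ := (hlink d hdm hdl').resolve_left hds
      have h1 := c.mul_le_sum_gross (T := q u) (A := (q u).satellites.erase e)
        ((Finset.erase_subset _ _).trans (Finset.subset_insert _ _))
        fun y hy => he y (Finset.mem_of_mem_erase hy) (Finset.ne_of_mem_erase hy)
      have h2 : (2 : ℤ) ≤ ((q u).satellites.erase e).card := by
        have := Finset.pred_card_le_card_erase (s := (q u).satellites) (a := e)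
        omega
      have h3 := c.loadCount_le_sum hloads
      rw [Finset.card_singleton] at h3
      have h3 : (loadCount k p q (q u) : ℤ) ≤ 1 := by exact_mod_cast h3
      nlinarith
    · have h0 : loadCount k p q (q u) = 0 := by
        refine Nat.le_zero.1 (c.loadCount_le_sum (A := ∅) fun v hv hl => ?_)
        exact absurd (Finset.mem_singleton.1 (hloads v hv hl) ▸ hl) hdl
      rw [h0]
      by_cases hb : IsBad k p (q u)
      · rw [if_pos hb]
        have := Finset.sum_nonneg fun v (_ : v ∈ (q u).verts) => c.gross_nonneg v
        push_cast
        linarith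
      · obtain ⟨v, hv, hv2⟩ : ∃ v ∈ (q u).verts, (p v).order ≠ 2 := by
          by_contra! hcon
          exact hb ⟨hu, hcon⟩
        have hvd : v ≠ d := fun e => hv2 (e ▸ h)
        have h1 := c.le_sum_gross hv
        suffices (k : ℤ) - 2 ≤ gross k p q v by push_cast; linarith
        -- A vertex outside 2-stars is strong or the center of a 3-star that is not spare; either is
        -- worth k-2.
        by_cases hvs : IsStrong p v
        · exact c.le_gross_of_isStrong hvs
        · have hvc : (p v).IsCriticalIn v := by
            by_contra hvc
            exact hvs (c.isStrong_of_adj (by omega)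
              (hadj v (Star.mem_satellites_of_ne_center hv hvd)) hvc)
          exact (gross_of_three hvs (hvc.1.resolve_left hv2)
            fun hs => hspare v hv hvd hs hcrit).ge
  · by_cases hsp : IsSpare k p q d
    · refine (hall fun y hy => c.isStrong_of_adj (by omega) (hadj y hy) ?_).trans (by linarith)
      rcases hsp.2.2 with hlt | hn
      · rw [hqd] at hlt
        omega
      · rw [hqd] at hn
        exact hn y (Star.mem_verts_of_mem_satellites hy) (hadj y hy).ne' (Or.inl rfl)
    · have hcrit : (p d).IsCriticalIn d := by
        by_contra hc
        exact hds ⟨h.ge, hc⟩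
      have h0 : loadCount k p q (q u) = 0 := by
        refine Nat.le_zero.1 (c.loadCount_le_sum (A := ∅) fun v hv hl => ?_)
        rcases hl with hl | hl
        · have e := ((hlink v hv hl).resolve_left hds).1
          have := c.order_of_isLink hl
          rw [← e] at this
          omega
        · exact absurd hcrit (hspare v hv (fun e => hsp (e ▸ hl)) hl)
      have h1 := c.le_sum_gross hdm
      rw [gross_of_three hds h hsp] at h1
      rw [h0]
      push_cast
      linarith
  · exact absurd (c.isStrong_of_four_le h) hds

open Classical in
/-- Every star of the other collection can pay what it has to. -/
theorem le_sum_income (c : Config G k p q) (u : V) :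
    (k : ℤ) - 2 + ((q u).verts.filter (IsLink k p q)).card ≤
      (4 * k - 7) * (k - (q u).order - if (q u).order = 1 then 1 else 0) +
      ∑ v ∈ (q u).verts, income k p q v + if IsBad k p (q u) then (k : ℤ) - 2 else 0 := by
  have hk := c.four_le
  have hkz : (4 : ℤ) ≤ k := by exact_mod_cast hk
  have hcount : loadCount k p q (q u) =
      ((q u).verts.filter (IsLink k p q)).card + ((q u).verts.filter (IsSpare k p q)).card := by
    rw [loadCount, ← Finset.card_union_of_disjoint, ← Finset.filter_or]
    · congr 1
      ext v
      simp only [Finset.mem_filter, IsLoad]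
    · rw [Finset.disjoint_filter]
      intro v _ hl hs
      have h1 := hs.1
      have h2 := c.order_of_isLink hl
      omega
  have hsum : ∑ v ∈ (q u).verts, gross k p q v = ∑ v ∈ (q u).verts, income k p q v +
      ((q u).verts.filter (IsSpare k p q)).card := by
    simp only [gross, Finset.sum_add_distrib, Finset.sum_boole]
  suffices (k : ℤ) - 2 + loadCount k p q (q u) ≤
      (4 * k - 7) * (k - (q u).order - if (q u).order = 1 then 1 else 0) +
      ∑ v ∈ (q u).verts, gross k p q v + if IsBad k p (q u) then (k : ℤ) - 2 else 0 by
    rw [hcount, hsum] at this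
    push_cast at this
    linarith
  rcases (c.q_le u).lt_or_eq with hlt | heq
  -- One unit of unused capacity is worth 4k-7, which covers k-2 and at most k-1 loads. It remains
  -- even for a 1-star, as k ≥ 4.
  · have h1 : (1 : ℤ) ≤ k - (q u).order - if (q u).order = 1 then 1 else 0 := by
      split_ifs <;> omega
    have h2 : (loadCount k p q (q u) : ℤ) + 1 ≤ k := by
      have := loadCount_le_order (k := k) (p := p) (q := q) (T := q u)
      omega
    have h3 := Finset.sum_nonneg fun v (_ : v ∈ (q u).verts) => c.gross_nonneg v
    have h4 : (0 : ℤ) ≤ if IsBad k p (q u) then (k : ℤ) - 2 else 0 := by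
      split_ifs <;> linarith
    nlinarith
  · have := c.le_sum_gross_of_order_eq heq
    rw [if_neg (show ¬ (q u).order = 1 by omega), heq]
    linarith

/-! ### Counting sources and links. -/

open Classical in
/-- A bad star contains at least `k - 2` sources of links. -/
theorem le_card_linkSource (c : Config G k p q) (hb : IsBad k p (q u)) :
    k - 2 ≤ ((q u).verts.filter (IsSource k p q)).card := by
  have hcard := (c.star_q u).card_satellites
  have hord := hb.1
  -- Of the k-1 satellites, only the partner `e` of the center can fail to be a source.
  obtain ⟨e, he, hec⟩ := Star.exists_ne_of_order_eq_two
    (hb.2 _ (Star.center_mem_verts (q u))) (q u).center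
  have h1 := Finset.pred_card_le_card_erase (s := (q u).satellites) (a := e)
  suffices ((q u).satellites.erase e).card ≤
      ((q u).verts.filter (IsSource k p q)).card by omega
  refine Finset.card_le_card fun x hx => ?_
  rw [Finset.mem_erase] at hx
  have hxm := Star.mem_verts_of_mem_satellites hx.2
  have hqx := c.eq_q hxm
  have hxc := (c.star_q u).ne_center hx.2
  obtain ⟨v, hv, hvx⟩ := Star.exists_ne_of_order_eq_two (hb.2 x hxm) x
  refine Finset.mem_filter.2 ⟨hxm, v, ?_⟩
  unfold IsLinkSource
  rw [hqx]
  refine ⟨hb, hxc, hvx.symm, hv, fun hvc => ?_⟩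
  have hpv := c.eq_p hv
  have hxp := c.mem_p x
  rw [← hpv, hvc] at hxp
  rcases Star.eq_or_eq_of_order_eq_two (hb.2 _ (Star.center_mem_verts (q u))) hec he
    (c.mem_p _) hxp with h | h
  exacts [hx.1 h, hxc h]

open Classical in
/-- Different sources have different links. -/
theorem card_linkSource_le [Fintype V] (c : Config G k p q) :
    (Finset.univ.filter (IsSource k p q)).card ≤
      (Finset.univ.filter (IsLink k p q)).card := by
  -- A link determines its source as the other vertex of its 2-star.
  choose! f hf using fun x (hx : IsSource k p q x) => hx
  refine Finset.card_le_card_of_injOn f (fun x hx => ?_) fun x hx y hy hxy => ?_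
  · simp only [Finset.coe_filter, Finset.mem_univ, true_and, Set.mem_ofPred_eq] at hx ⊢
    exact ⟨x, hf x hx⟩
  · simp only [Finset.coe_filter, Finset.mem_univ, true_and, Set.mem_ofPred_eq] at hx hy
    have h1 := hf x hx
    have h2 := hf y hy
    have hm := c.mem_p y
    rw [← c.link_eq h2, ← hxy, c.link_eq h1] at hm
    rcases Star.eq_or_eq_of_order_eq_two (c.link_order h1 (c.mem_q x)) h1.2.2.1 (c.mem_p x)
      h1.2.2.2.1 hm with h | h
    · exact h.symm
    · exact absurd (h.trans hxy) h2.2.2.1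

end Config

/-! ### Summation over both partitions. -/

namespace IsPartition

theorem sum_order [Fintype V] (h : IsPartition G k P) :
    ∑ S ∈ P, (S.order : ℤ) = Fintype.card V := by
  have := h.sum_sum_verts (fun _ => (1 : ℤ))
  simpa [Star.order] using this

/-- The subtraction is truncated: a 1-star contributes 0 instead of -1, whence the term for 1-stars.
-/
theorem sum_order_sub_two [Fintype V] (h : IsPartition G k P) :
    ∑ S ∈ P, ((S.order - 2 : ℕ) : ℤ) = Fintype.card V + numOneStars P - 2 * P.card := by
  have h1 : ∀ S ∈ P, ((S.order - 2 : ℕ) : ℤ) =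
      S.order + (if S.order = 1 then 1 else 0) - 2 := by
    intro S _
    have := S.order_pos
    split_ifs <;> omega
  rw [Finset.sum_congr rfl h1, Finset.sum_sub_distrib, Finset.sum_add_distrib, h.sum_order,
    Finset.sum_boole, Finset.sum_const, numOneStars, nsmul_eq_mul]
  ring

end IsPartition

/-- The ratio between a stuck partition and any other partition. -/
theorem IsStuck.card_le [Fintype V] (hk : 4 ≤ k) (h : IsStuck G k P) (hQ : IsPartition G k Q) :
    (4 * (k : ℤ) - 7) * P.card ≤ (2 * (k : ℤ) ^ 2 - 4 * k + 1) * Q.card := by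
  classical
  have hP := h.isPartition
  have c := h.config hk hQ
  set p := h.isPartition.starAt
  set q := hQ.starAt
  have hkz : (4 : ℤ) ≤ k := by exact_mod_cast hk
  have hp : ∀ S ∈ P, p S.center = S := fun S hS => hP.starAt_eq hS S.center_mem_verts
  have hq : ∀ T ∈ Q, q T.center = T := fun T hT => hQ.starAt_eq hT T.center_mem_verts
  have hpay := Finset.sum_le_sum fun T (hT : T ∈ Q) => by
    have := c.le_sum_income T.center
    rwa [hq T hT] at this
  have hgive := Finset.sum_le_sum fun S (hS : S ∈ P) => by
    have := c.sum_income_le S.center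
    rwa [hp S hS] at this
  have hsource := Finset.sum_le_sum fun T (hT : T ∈ Q) => by
    have : (if IsBad k p T then (k : ℤ) - 2 else 0) ≤
        ((T.verts.filter (IsSource k p q)).card : ℤ) := by
      split_ifs with hb
      · have := c.le_card_linkSource (u := T.center) (by rwa [hq T hT])
        rw [hq T hT] at this
        omega
      · positivity
    exact this
  have hcount : ∀ r : V → Prop, ∑ T ∈ Q, ((T.verts.filter r).card : ℤ) =
      (Finset.univ.filter r).card := by
    intro r
    have := hQ.sum_sum_verts (fun v => if r v then (1 : ℤ) else 0)
    simpa only [Finset.sum_boole] using this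
  rw [hcount] at hsource
  rw [hP.sum_sum_verts, ← Finset.mul_sum, hP.sum_order_sub_two] at hgive
  simp only [Finset.sum_add_distrib, Finset.sum_sub_distrib, ← Finset.mul_sum, hcount,
    hQ.sum_sum_verts, hQ.sum_order, Finset.sum_const, nsmul_eq_mul, Finset.sum_boole] at hpay
  have hlinks : ((Finset.univ.filter (IsSource k p q)).card : ℤ) ≤
      (Finset.univ.filter (IsLink k p q)).card := by exact_mod_cast c.card_linkSource_le
  have hone : (numOneStars P : ℤ) ≤ (Q.filter fun T => T.order = 1).card := by
    exact_mod_cast h.isStart.2 Q hQ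
  -- The k-2 units granted to each bad star are covered by `hsource` and `hlinks`, so they cancel
  -- against the links in `hpay`; `hgive` bounds the total income, and `hone` is multiplied by 4k-7.
  nlinarith

end StarPartition

theorem theorem2 {V : Type*} [Fintype V] [DecidableEq V] (G : SimpleGraph V) (k : ℕ) (hk : 4 ≤ k) :
    -- the algorithm can start, and it always stops
    (∃ P₀, StarPartition.IsApprox1Start G k P₀) ∧
    (¬ ∃ run : ℕ → Finset (StarPartition.Star V),
      StarPartition.IsApprox1Start G k (run 0) ∧
        ∀ i, StarPartition.Step G k (run i) (run (i + 1))) ∧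
    -- every output is a `k⁻`-star partition within the claimed ratio of an optimal one
    (∀ P, StarPartition.IsApprox1Output G k P →
      StarPartition.IsPartition G k P ∧
        ∀ Q, StarPartition.IsOptimal G k Q →
          (P.card : ℝ) ≤ (2 * (k : ℝ) ^ 2 - 4 * k + 1) / (4 * k - 7) * Q.card) ∧
    -- the two forms of the ratio
    (2 * (k : ℝ) ^ 2 - 4 * k + 1) / (4 * k - 7) = (k : ℝ) / 2 - ((k : ℝ) - 2) / (8 * k - 14) := by
  have hk4 : (4 : ℝ) ≤ k := by exact_mod_cast hk
  have h7 : (0 : ℝ) < 4 * k - 7 := by linarith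
  refine ⟨StarPartition.exists_isApprox1Start G (by omega),
    StarPartition.not_exists_infinite_run hk, fun P hP => ?_, ?_⟩
  · have hs := hP.isStuck hk
    refine ⟨hs.isPartition, fun Q hQ => ?_⟩
    have h : (4 * (k : ℝ) - 7) * P.card ≤ (2 * (k : ℝ) ^ 2 - 4 * k + 1) * Q.card := by
      exact_mod_cast hs.card_le hk hQ.1
    rw [div_mul_eq_mul_div, le_div_iff₀ h7]
    linarith
  · have h14 : (0 : ℝ) < 8 * k - 14 := by linarith
    rw [div_sub_div _ _ two_ne_zero h14.ne',
      div_eq_div_iff h7.ne' (mul_pos two_pos h14).ne']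
    ring
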